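/- Let $S$ be a geodesic metric space and put $(x|y)_o=\tfrac12\bigl(d(x,o)+d(y,o)-d(x,y)\bigr)$. Call $S$ hyperbolic if there is $\delta$ with $(x|y)_o\ge\min\{(x|z)_o,(z|y)_o\}-\delta$ for all $x,y,z,o\in S$. Its Gromov boundary $\partial S$ is the set of equivalence classes of sequences $(x_i)$ in $S$ with $(x_i|x_j)_o\to\infty$ as $i,j\to\infty$, where $(x_i)\sim(y_i)$ if $(x_i|y_j)_o\to\infty$ as $i,j\to\infty$. The Gromov product extends to $a\in\partial S$ and $s\in S\cup\partial S$: $(a|s)_o$ is the infimum of $\liminf_i (x_i|s)_o$ (if $s\in S$), respectively of $\liminf_{i,j}(x_i|y_j)_o$ (if $s\in\partial S$), over all sequences $(x_i)$ representing $a$ and $(y_j)$ representing $s$. The set $S\cup\partial S$ carries the topology in which $V$ is open if and only if $V\cap S$ is open in $S$ and, for each $a\in V\cap\partial S$ and each $o\in S$, $V$ contains $\{s\in S\cup\partial S : (a|s)_o>r\}$ for some $r\in\mathbb R$. Let a group $G$ act by isometries on a hyperbolic space $S$. The limit set $\Lambda_S(G)$ is the set of points of $\partial S$ that lie in the closure of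 a $G$-orbit of a point of $S$, with the subspace topology and the induced action of $G$. An element $g\in G$ is loxodromic if $\langle g\rangle$ has unbounded orbits in $S$ and fixes exactly two points of $\partial S$. The action is of general type if its orbits are unbounded and $G$ contains two loxodromic elements whose sets of fixed points in $\partial S$ are disjoint. A group $G$ is a lim-free weakly hyperbolic group if it admits an isometric action of general type on a (geodesic) hyperbolic space $S$ such that the induced action on $\Lambda_S(G)$ is topologically free, i.e. for every $g\in G\setminus\{1\}$ the set of points of $\Lambda_S(G)$ fixed by $g$ has empty interior in $\Lambda_S(G)$. For $w=w(t)$ in the free product $G*\langle t\rangle$ of $G$ with an infinite cyclic group and for $g\in G$, let $w(g)\in G$ be the image of $w$ under the homomorphism $G*\langle t\rangle\to G$ that is the identity on $G$ and sends $t$ to $g$. The Zariski topology on $G$ is the topology for which the sets $\{g\in G : w(g)=1\}$, $w\in G*\langle t\rangle$, form a sub-basis of the closed sets. **Corollary.** Let $G$ be a lim-free weakly hyperbolic group, and let $H$ be a normal subgroup of $G$ that is closed in the Zariski topology of $G$. Then $H=\{1\}$ or $H=G$. -/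

import Mathlib

open Filter Topology

universe u v

namespace WeakHyp

/-! ### Hyperbolic spaces -/

/-- The Gromov product `(x | y)_o` of two points of a metric space with respect to `o`. -/
noncomputable def gromovProduct {S : Type v} [MetricSpace S] (o x y : S) : ℝ :=
  (dist x o + dist y o - dist x y) / 2

/-- A geodesic metric space which is Gromov hyperbolic (four point condition). -/
class IsHyperbolicSpace (S : Type v) [MetricSpace S] : Prop where
  exists_geodesic : ∀ x y : S, ∃ γ : ℝ → S, γ 0 = x ∧ γ (dist x y) = y ∧
    ∀ s ∈ Set.Icc 0 (dist x y), ∀ t ∈ Set.Icc 0 (dist x y), dist (γ s) (γ t) = |s - t|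
  exists_delta : ∃ δ : ℝ, ∀ x y z o : S,
    min (gromovProduct o x z) (gromovProduct o z y) - δ ≤ gromovProduct o x y

theorem gromovProduct_comm {S : Type v} [MetricSpace S] (o x y : S) :
    gromovProduct o x y = gromovProduct o y x := by
  unfold gromovProduct
  rw [dist_comm x y]
  ring

theorem gromovProduct_smul {G : Type u} {S : Type v} [Group G] [MetricSpace S] [MulAction G S]
    [IsIsometricSMul G S] (g : G) (o x y : S) :
    gromovProduct (g • o) (g • x) (g • y) = gromovProduct o x y := by
  simp [gromovProduct]

/-! ### The Gromov boundary -/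

/-- `(x_i | y_j)_o → ∞` as `i, j → ∞`, for every base point `o`. -/
def DivergesTogether {S : Type v} [MetricSpace S] (x y : ℕ → S) : Prop :=
  ∀ o : S, Tendsto (fun p : ℕ × ℕ => gromovProduct o (x p.1) (y p.2)) atTop atTop

theorem divergesTogether_iff {S : Type v} [MetricSpace S] {x y : ℕ → S} :
    DivergesTogether x y ↔
      ∀ (o : S) (B : ℝ), ∃ N, ∀ i ≥ N, ∀ j ≥ N, B ≤ gromovProduct o (x i) (y j) := by
  simp only [DivergesTogether, tendsto_atTop, eventually_atTop_prod_self']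

theorem DivergesTogether.symm {S : Type v} [MetricSpace S] {x y : ℕ → S}
    (h : DivergesTogether x y) : DivergesTogether y x := by
  rw [divergesTogether_iff] at h ⊢
  intro o B
  obtain ⟨N, hN⟩ := h o B
  exact ⟨N, fun i hi j hj => (gromovProduct_comm o (y i) (x j)).symm ▸ hN j hj i hi⟩

theorem DivergesTogether.trans {S : Type v} [MetricSpace S] [IsHyperbolicSpace S]
    {x y z : ℕ → S} (h₁ : DivergesTogether x y) (h₂ : DivergesTogether y z) :
    DivergesTogether x z := by
  rw [divergesTogether_iff] at h₁ h₂ ⊢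
  intro o B
  obtain ⟨δ, hδ⟩ := IsHyperbolicSpace.exists_delta (S := S)
  obtain ⟨N₁, hN₁⟩ := h₁ o (B + δ)
  obtain ⟨N₂, hN₂⟩ := h₂ o (B + δ)
  refine ⟨max N₁ N₂, fun i hi k hk => ?_⟩
  have e₁ := hN₁ i (le_trans (le_max_left _ _) hi) (max N₁ N₂) (le_max_left _ _)
  have e₂ := hN₂ (max N₁ N₂) (le_max_right _ _) k (le_trans (le_max_right _ _) hk)
  have := hδ (x i) (z k) (y (max N₁ N₂)) o
  have := le_min e₁ e₂
  linarith

theorem DivergesTogether.smul {G : Type u} {S : Type v} [Group G] [MetricSpace S]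
    [MulAction G S] [IsIsometricSMul G S] (g : G) {x y : ℕ → S} (h : DivergesTogether x y) :
    DivergesTogether (g • x) (g • y) := by
  intro o
  refine (h (g⁻¹ • o)).congr fun p => ?_
  rw [← gromovProduct_smul g]
  simp

/-- The sequences in `S` that converge at infinity. -/
def ConvSeq (S : Type v) [MetricSpace S] : Type v :=
  {x : ℕ → S // DivergesTogether x x}

/-- Equivalence of sequences converging at infinity. -/
def convSeqSetoid (S : Type v) [MetricSpace S] [IsHyperbolicSpace S] : Setoid (ConvSeq S) where
  r x y := DivergesTogether x.1 y.1
  iseqv := ⟨fun x => x.2, fun h => h.symm, fun h₁ h₂ => h₁.trans h₂⟩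

/-- The Gromov boundary of `S`. -/
def Boundary (S : Type v) [MetricSpace S] [IsHyperbolicSpace S] : Type v :=
  Quotient (convSeqSetoid S)

/-- The point of the boundary to which a sequence converges. -/
def ConvSeq.limit {S : Type v} [MetricSpace S] [IsHyperbolicSpace S] (x : ConvSeq S) :
    Boundary S :=
  Quotient.mk (convSeqSetoid S) x

/-- The bordification `S ∪ ∂S`. -/
inductive Bordification (S : Type v) [MetricSpace S] [IsHyperbolicSpace S] : Type v
  | point : S → Bordification S
  | ideal : Boundary S → Bordification S

/-- The Gromov product `(a | s)_o ∈ [0, ∞]` of a boundary point `a` and a point `s` of `S ∪ ∂S`: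
the infimum of the lower limits over all sequences that represent the boundary points. -/
noncomputable def extGromovProduct {S : Type v} [MetricSpace S] [IsHyperbolicSpace S]
    (o : S) (a : Boundary S) : Bordification S → EReal
  | .point s => ⨅ (x : ConvSeq S) (_ : x.limit = a),
      liminf (fun i : ℕ => ((gromovProduct o (x.1 i) s : ℝ) : EReal)) atTop
  | .ideal b => ⨅ (x : ConvSeq S) (_ : x.limit = a) (y : ConvSeq S) (_ : y.limit = b),
      liminf (fun p : ℕ × ℕ => ((gromovProduct o (x.1 p.1) (y.1 p.2) : ℝ) : EReal)) atTop

/-- The basic neighbourhood `{s ∈ S ∪ ∂S | (a | s)_o > r}` of a boundary point `a`. -/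
def basicNhd {S : Type v} [MetricSpace S] [IsHyperbolicSpace S] (o : S) (a : Boundary S) (r : ℝ) :
    Set (Bordification S) :=
  {s | (r : EReal) < extGromovProduct o a s}

theorem basicNhd_anti {S : Type v} [MetricSpace S] [IsHyperbolicSpace S] (o : S)
    (a : Boundary S) {r r' : ℝ} (h : r ≤ r') : basicNhd o a r' ⊆ basicNhd o a r :=
  fun _ hs => lt_of_le_of_lt (EReal.coe_le_coe_iff.2 h) hs

/-- The topology of `S ∪ ∂S`: a set is open if its trace on `S` is open and it contains a basic
neighbourhood of each of its boundary points. -/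
instance (S : Type v) [MetricSpace S] [IsHyperbolicSpace S] :
    TopologicalSpace (Bordification S) where
  IsOpen V := IsOpen (Bordification.point ⁻¹' V) ∧
    ∀ a : Boundary S, Bordification.ideal a ∈ V → ∀ o : S, ∃ r : ℝ, basicNhd o a r ⊆ V
  isOpen_univ := ⟨by simp, fun _ _ _ => ⟨0, Set.subset_univ _⟩⟩
  isOpen_inter V W hV hW := by
    refine ⟨hV.1.inter hW.1, fun a ha o => ?_⟩
    obtain ⟨r, hr⟩ := hV.2 a ha.1 o
    obtain ⟨t, ht⟩ := hW.2 a ha.2 o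
    exact ⟨max r t, Set.subset_inter ((basicNhd_anti o a (le_max_left r t)).trans hr)
      ((basicNhd_anti o a (le_max_right r t)).trans ht)⟩
  isOpen_sUnion F hF := by
    refine ⟨?_, ?_⟩
    · rw [Set.preimage_sUnion]
      exact isOpen_biUnion fun V hV => (hF V hV).1
    · rintro a ⟨V, hV, ha⟩ o
      obtain ⟨r, hr⟩ := (hF V hV).2 a ha o
      exact ⟨r, hr.trans (Set.subset_sUnion_of_mem hV)⟩

/-- The topology of the boundary, as a subspace of `S ∪ ∂S`. -/
instance (S : Type v) [MetricSpace S] [IsHyperbolicSpace S] : TopologicalSpace (Boundary S) :=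
  TopologicalSpace.induced Bordification.ideal inferInstance

/-! ### Isometric group actions -/

section Action

variable (G : Type u) (S : Type v) [Group G] [MetricSpace S] [IsHyperbolicSpace S]
  [MulAction G S] [IsIsometricSMul G S]

instance : MulAction G (ConvSeq S) where
  smul g x := ⟨g • x.1, x.2.smul g⟩
  one_smul x := Subtype.ext (one_smul G x.1)
  mul_smul g h x := Subtype.ext (mul_smul g h x.1)

instance : MulAction G (Boundary S) where
  smul g := Quotient.map (sa := convSeqSetoid S) (sb := convSeqSetoid S) (fun x => g • x)
    (fun _ _ h => DivergesTogether.smul g h)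
  one_smul a := by
    induction a using Quotient.inductionOn with
    | h x => exact congrArg (Quotient.mk (convSeqSetoid S)) (one_smul G x)
  mul_smul g h a := by
    induction a using Quotient.inductionOn with
    | h x => exact congrArg (Quotient.mk (convSeqSetoid S)) (mul_smul g h x)

instance : MulAction G (Bordification S) where
  smul g
    | .point s => .point (g • s)
    | .ideal a => .ideal (g • a)
  one_smul
    | .point s => congrArg Bordification.point (one_smul G s)
    | .ideal a => congrArg Bordification.ideal (one_smul G a)
  mul_smul g h
    | .point s => congrArg Bordification.point (mul_smul g h s)
    | .ideal a => congrArg Bordification.ideal (mul_smul g h a)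

variable {G S}

theorem smul_limit (g : G) (x : ConvSeq S) : (g • x).limit = g • x.limit := rfl

theorem extGromovProduct_smul (g : G) (o : S) (a : Boundary S) (s : Bordification S) :
    extGromovProduct (g • o) (g • a) (g • s) = extGromovProduct o a s := by
  have key : ∀ (b : Boundary S) (x : ConvSeq S), x.limit = b ↔
      ((MulAction.toPerm g : Equiv.Perm (ConvSeq S)) x).limit = g • b := fun b x => by
    simp [smul_limit]
  cases s with
  | point s =>
    refine (Equiv.iInf_congr (MulAction.toPerm g) fun x => ?_).symm
    refine iInf_congr_Prop (key a x).symm fun _ => ?_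
    exact congrArg (fun f => liminf f atTop)
      (funext fun i => congrArg _ (gromovProduct_smul g o (x.1 i) s))
  | ideal b =>
    refine (Equiv.iInf_congr (MulAction.toPerm g) fun x => ?_).symm
    refine iInf_congr_Prop (key a x).symm fun _ => ?_
    symm
    refine Equiv.iInf_congr (MulAction.toPerm g) fun y => ?_
    symm
    refine iInf_congr_Prop (key b y) fun _ => ?_
    exact congrArg (fun f => liminf f atTop)
      (funext fun p => congrArg _ (gromovProduct_smul g o (x.1 p.1) (y.1 p.2)).symm)

/-- The group acts on `S ∪ ∂S` by homeomorphisms. -/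
instance : ContinuousConstSMul G (Bordification S) where
  continuous_const_smul g := by
    refine continuous_def.2 fun V hV => ⟨?_, fun a ha o => ?_⟩
    · exact hV.1.preimage (continuous_const_smul g)
    · obtain ⟨r, hr⟩ := hV.2 (g • a) ha (g • o)
      refine ⟨r, fun s hs => hr ?_⟩
      change (r : EReal) < extGromovProduct (g • o) (g • a) (g • s)
      rw [extGromovProduct_smul]
      exact hs

variable (G S)

/-- The limit set: the boundary points in the closure of an orbit in `S ∪ ∂S`, as an invariant
subset of the boundary. -/
def limitSet : SubMulAction G (Boundary S) where
  carrier := {a | ∃ s : S, Bordification.ideal a ∈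
    closure (Bordification.point '' MulAction.orbit G s)}
  smul_mem' := by
    rintro g a ⟨s, hs⟩
    refine ⟨s, ?_⟩
    refine map_mem_closure (f := fun z : Bordification S => g • z) (continuous_const_smul g) hs ?_
    rintro _ ⟨_, ⟨h, rfl⟩, rfl⟩
    exact ⟨g • h • s, ⟨g * h, mul_smul g h s⟩, rfl⟩

variable {G}

/-- `g` is loxodromic: the orbits of `⟨g⟩` are unbounded and `⟨g⟩` fixes exactly two points of
the boundary (these are the points fixed by `g`). -/
def IsLoxodromic (g : G) : Prop :=
  (∀ s : S, ¬ Bornology.IsBounded (MulAction.orbit (Subgroup.zpowers g) s)) ∧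
    (MulAction.fixedBy (Boundary S) g).encard = 2

variable (G)

/-- The action is of general type: orbits are unbounded and there are two loxodromic elements
with disjoint sets of fixed points on the boundary. -/
def IsGeneralType : Prop :=
  (∀ s : S, ¬ Bornology.IsBounded (MulAction.orbit G s)) ∧
    ∃ g h : G, IsLoxodromic S g ∧ IsLoxodromic S h ∧
      Disjoint (MulAction.fixedBy (Boundary S) g)
        (MulAction.fixedBy (Boundary S) h)

end Action

/-- The fixed point set of every non-trivial element has empty interior. -/
def IsTopologicallyFree (G : Type u) (X : Type v) [Group G] [TopologicalSpace X]
    [MulAction G X] : Prop :=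
  ∀ g : G, g ≠ 1 → interior (MulAction.fixedBy X g) = ∅

/-- A lim-free weakly hyperbolic group: it has a general type action by isometries on a geodesic
hyperbolic space whose induced action on the limit set is topologically free. -/
def IsLimFreeWeaklyHyperbolic (G : Type u) [Group G] : Prop :=
  ∃ (S : Type v) (_ : MetricSpace S) (_ : IsHyperbolicSpace S) (_ : MulAction G S)
    (_ : IsIsometricSMul G S), IsGeneralType G S ∧ IsTopologicallyFree G (limitSet G S)

/-! ### The Zariski topology of a group -/

/-- The value `w(g)` of a word `w(t) ∈ G * ⟨t⟩`: the image of `w` under the homomorphism to `G`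
that is the identity on `G` and maps `t` to `g`. -/
def evalWord {G : Type u} [Group G] (g : G) : Monoid.Coprod G (Multiplicative ℤ) →* G :=
  Monoid.Coprod.lift (MonoidHom.id G) (zpowersHom G g)

/-- The solution set of the equation `w(t) = 1` in `G`. -/
def solutionSet {G : Type u} [Group G] (w : Monoid.Coprod G (Multiplicative ℤ)) : Set G :=
  {g | evalWord g w = 1}

/-- The Zariski topology: the solution sets form a sub-basis of the closed sets. -/
abbrev zariskiTopology (G : Type u) [Group G] : TopologicalSpace G :=
  TopologicalSpace.generateFrom {U | ∃ w, U = (solutionSet w)ᶜ}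

end WeakHyp

/-! Suppose `H` is normal, Zariski closed, non-trivial and misses some `x`. A basic open
neighbourhood of `x` outside `H` is cut out by finitely many inequations `w(t) ≠ 1`, each satisfied
at `x`. A common solution `t ∈ H` is therefore a contradiction, and ping-pong produces one.

Up to conjugation, a non-constant word alternates between powers of `t` and non-trivial
coefficients. It cannot vanish at `t` if, for some proper subset `A` of `S`, the non-zero powers of
`t` map the complement of `A` into `A` and the coefficients move `A` off itself
(`exists_finset_evalWord_ne_one`).

Topological freeness yields a limit point moved by all the coefficients and by a chosen `n ≠ 1` of
`H` with its inverse (`exists_forall_smul_ne`); `A` is a small shadow of that point. General type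
yields `X` such that `X^{±1}` and `X^{±2}` map the complement of `A` into `A`
(`IsGeneralType.exists_zpow_smul_towards`). A conjugate of the commutator of `X⁻¹` and `n` lies in
`H` and plays the role of `t` (`pingPong_conj_commutator`). -/

namespace WeakHyp

/-! ### Alternating words -/

section Words

variable {G : Type u} [Group G]

open Monoid.Coprod

/-- The words `t ^ n₁ c₁ t ^ n₂ c₂ ⋯ t ^ nₖ` with `k ≥ 1`, non-zero exponents and non-trivial
coefficients. -/
inductive Alternating : Monoid.Coprod G (Multiplicative ℤ) → Prop
  | power (n : Multiplicative ℤ) (hn : n ≠ 1) : Alternating (inr n)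
  | cons (n : Multiplicative ℤ) (hn : n ≠ 1) (c : G) (hc : c ≠ 1)
      (w : Monoid.Coprod G (Multiplicative ℤ)) (hw : Alternating w) :
      Alternating (inr n * (inl c * w))

theorem exists_eq_inl_or_alternating (w : Monoid.Coprod G (Multiplicative ℤ)) :
    (∃ g, w = inl g) ∨ ∃ a b m, Alternating m ∧ w = inl a * m * inl b := by
  induction w using Monoid.Coprod.induction_on' with
  | one => exact Or.inl ⟨1, by simp⟩
  | inl_mul g w ih =>
    rcases ih with ⟨h, rfl⟩ | ⟨a, b, m, hm, rfl⟩
    · exact Or.inl ⟨g * h, by simp⟩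
    · exact Or.inr ⟨g * a, b, m, hm, by simp [mul_assoc]⟩
  | inr_mul n w ih =>
    by_cases hn : n = 1
    · subst hn
      simpa using ih
    rcases ih with ⟨h, rfl⟩ | ⟨a, b, m, hm, rfl⟩
    · exact Or.inr ⟨1, h, inr n, .power n hn, by simp⟩
    by_cases ha : a = 1
    · subst ha
      cases hm with
      | power k hk =>
        by_cases hnk : n * k = 1
        · refine Or.inl ⟨b, ?_⟩
          rw [map_one, one_mul, ← mul_assoc, ← map_mul, hnk, map_one, one_mul]
        · exact Or.inr ⟨1, b, _, .power _ hnk, by simp [mul_assoc]⟩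
      | cons k hk c hc m hm =>
        by_cases hnk : n * k = 1
        · refine Or.inr ⟨c, b, m, hm, ?_⟩
          rw [map_one, one_mul, mul_assoc, ← mul_assoc, ← map_mul, hnk, map_one, one_mul]
        · exact Or.inr ⟨1, b, _, .cons _ hnk c hc m hm, by simp [mul_assoc]⟩
    · exact Or.inr ⟨1, b, _, .cons n hn a ha m hm, by simp [mul_assoc]⟩

theorem Alternating.exists_mul_inr {m : Monoid.Coprod G (Multiplicative ℤ)}
    (hm : Alternating m) : ∃ n, ∀ k, k ≠ n → Alternating (m * inr k) := by
  induction hm with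
  | power n hn =>
    refine ⟨n⁻¹, fun k hk => ?_⟩
    rw [← map_mul]
    exact .power _ fun h => hk (eq_inv_of_mul_eq_one_right h)
  | cons n hn c hc w hw ih =>
    obtain ⟨j, hj⟩ := ih
    refine ⟨j, fun k hk => ?_⟩
    rw [mul_assoc, mul_assoc]
    exact .cons n hn c hc _ (hj k hk)

/-- Conjugation removes the outer coefficients, so that ping-pong can start outside `A` and end
inside `A`. -/
theorem exists_eq_inl_or_conj_alternating (w : Monoid.Coprod G (Multiplicative ℤ)) :
    (∃ g, w = inl g) ∨ ∃ v, Alternating (v * w * v⁻¹) := by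
  rcases exists_eq_inl_or_alternating w with h | ⟨a, b, m, hm, rfl⟩
  · exact Or.inl h
  right
  by_cases hba : b * a = 1
  · refine ⟨inl b, ?_⟩
    have : (inl b * (inl a * m * inl b) * (inl b)⁻¹ : Monoid.Coprod G (Multiplicative ℤ))
        = inl (b * a) * m := by
      rw [map_mul]; group
    rwa [this, hba, map_one, one_mul]
  · obtain ⟨n, hn⟩ := hm.exists_mul_inr
    -- The exponent `n` might cancel the last power of `m`; `1` is the zero exponent, for which the
    -- new first power would vanish.
    obtain ⟨k, hk⟩ := Infinite.exists_notMem_finset ({n, 1} : Finset (Multiplicative ℤ))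
    simp only [Finset.mem_insert, Finset.mem_singleton, not_or] at hk
    refine ⟨inr k⁻¹ * inl b, ?_⟩
    have : (inr k⁻¹ * inl b * (inl a * m * inl b) * (inr k⁻¹ * inl b)⁻¹ :
        Monoid.Coprod G (Multiplicative ℤ)) = inr k⁻¹ * (inl (b * a) * (m * inr k)) := by
      rw [map_mul, map_inv]; group
    rw [this]
    exact .cons _ (inv_ne_one.2 hk.2) _ hba _ (hn k hk.1)

theorem evalWord_inl (t g : G) : evalWord t (inl g) = g := by
  simp [evalWord]

theorem evalWord_inr (t : G) (n : Multiplicative ℤ) :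
    evalWord t (inr n) = t ^ (Multiplicative.toAdd n) := by
  simp [evalWord]

variable {S : Type v} [MulAction G S]

/-- Read from the right: each power throws the point into `A`, each coefficient throws it out again.
`C` is the set of coefficients; it depends on the word alone, so `A` and `t` may be chosen after it.
-/
theorem Alternating.exists_finset {m : Monoid.Coprod G (Multiplicative ℤ)}
    (hm : Alternating m) : ∃ C : Finset G, 1 ∉ C ∧ ∀ (t : G) (A : Set S),
      (∀ n : ℤ, n ≠ 0 → ∀ s ∉ A, t ^ n • s ∈ A) → (∀ c ∈ C, ∀ s ∈ A, c • s ∉ A) →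
      ∀ s ∉ A, evalWord t m • s ∈ A := by
  classical
  induction hm with
  | power n hn =>
    refine ⟨∅, by simp, fun t A ht _ s hs => ?_⟩
    rw [evalWord_inr]
    exact ht _ (fun h => hn (toAdd_eq_zero.1 h)) s hs
  | cons n hn c hc w hw ih =>
    obtain ⟨C, hC, h⟩ := ih
    refine ⟨insert c C, by simp [hC, hc.symm], fun t A ht hA s hs => ?_⟩
    rw [map_mul, map_mul, evalWord_inr, evalWord_inl, mul_smul, mul_smul]
    refine ht _ (fun h => hn (toAdd_eq_zero.1 h)) _ (hA c (Finset.mem_insert_self c C) _ ?_)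
    exact h t A ht (fun d hd => hA d (Finset.mem_insert_of_mem hd)) s hs

theorem exists_finset_evalWord_ne_one {w : Monoid.Coprod G (Multiplicative ℤ)}
    (hw : ∃ g, evalWord g w ≠ 1) : ∃ C : Finset G, 1 ∉ C ∧ ∀ (t : G) (A : Set S),
      (∀ n : ℤ, n ≠ 0 → ∀ s ∉ A, t ^ n • s ∈ A) → (∀ c ∈ C, ∀ s ∈ A, c • s ∉ A) →
      A ≠ Set.univ → evalWord t w ≠ 1 := by
  rcases exists_eq_inl_or_conj_alternating w with ⟨g, rfl⟩ | ⟨v, hv⟩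
  · obtain ⟨g', hg'⟩ := hw
    refine ⟨∅, by simp, fun t A _ _ _ => ?_⟩
    rwa [evalWord_inl] at hg' ⊢
  · obtain ⟨C, hC, h⟩ := hv.exists_finset (S := S)
    refine ⟨C, hC, fun t A ht hA hne h1 => ?_⟩
    obtain ⟨s, hs⟩ := (Set.ne_univ_iff_exists_notMem A).1 hne
    have := h t A ht hA s hs
    rw [map_mul, map_mul, h1, map_inv, mul_one, mul_inv_cancel, one_smul] at this
    exact hs this

/-- If `X`, `X⁻¹`, `X²`, `X⁻²` map the complement of `A` into `A` and `n`, `n⁻¹` map `A` into its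
complement, then all non-zero powers of `X² (X⁻¹ n X n⁻¹) X⁻²` map the complement of `A`
into `A`. -/
theorem pingPong_conj_commutator {A : Set S} {X n : G}
    (hX : ∀ k ∈ ({1, -1, 2, -2} : Finset ℤ), ∀ s ∉ A, X ^ k • s ∈ A)
    (hn : ∀ s ∈ A, n • s ∉ A) (hn' : ∀ s ∈ A, n⁻¹ • s ∉ A) (k : ℤ) (hk : k ≠ 0) :
    ∀ s ∉ A, (X ^ 2 * (X⁻¹ * n * X * n⁻¹) * (X ^ 2)⁻¹) ^ k • s ∈ A := by
  have h1 : ∀ s ∉ A, X • s ∈ A := by simpa using hX 1 (by simp)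
  have h1' : ∀ s ∉ A, X⁻¹ • s ∈ A := by simpa using hX (-1) (by simp)
  have h2 : ∀ s ∉ A, X ^ 2 • s ∈ A := fun s hs => by
    have := hX 2 (by simp) s hs
    rwa [show X ^ (2 : ℤ) = X ^ 2 from zpow_natCast X 2] at this
  have h2' : ∀ s ∉ A, (X ^ 2)⁻¹ • s ∈ A := fun s hs => by
    have := hX (-2) (by simp) s hs
    rwa [zpow_neg, show X ^ (2 : ℤ) = X ^ 2 from zpow_natCast X 2] at this
  set q := X⁻¹ * n * X * n⁻¹ with hq
  have hqA : ∀ s ∈ A, q • s ∈ A := fun s hs => by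
    simpa [hq, mul_smul] using h1' _ (hn _ (h1 _ (hn' s hs)))
  have hqA' : ∀ s ∉ A, q⁻¹ • s ∉ A := fun s hs => by
    simpa [hq, mul_smul] using hn _ (h1' _ (hn' _ (h1 s hs)))
  -- The factor `X ^ 2` absorbs the leading `X⁻¹` of `q`, leaving `X n X n⁻¹`.
  have hXq : ∀ s ∈ A, X ^ 2 • q • s ∈ A := fun s hs => by
    have : X ^ 2 • q • s = X • n • X • n⁻¹ • s := by
      simp only [hq, ← mul_smul]
      congr 1
      group
    rw [this]
    exact h1 _ (hn _ (h1 _ (hn' s hs)))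
  intro s hs
  rw [conj_zpow, mul_smul, mul_smul]
  obtain ⟨m, rfl | rfl⟩ := k.eq_nat_or_neg
  · obtain ⟨m, rfl⟩ := Nat.exists_eq_succ_of_ne_zero (by simpa using hk)
    have key : ∀ j : ℕ, q ^ j • (X ^ 2)⁻¹ • s ∈ A := fun j => by
      induction j with
      | zero => simpa using h2' s hs
      | succ j ih => rw [pow_succ', mul_smul]; exact hqA _ ih
    rw [zpow_natCast, pow_succ' q, mul_smul]
    exact hXq _ (key m)
  · obtain ⟨m, rfl⟩ := Nat.exists_eq_succ_of_ne_zero (by simpa using hk)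
    -- Here `q⁻¹` ends in `X`, which shortens `X⁻²` to `X⁻¹`. The point then stays outside `A` until
    -- the final `X ^ 2`.
    have key : ∀ j : ℕ, q⁻¹ ^ (j + 1) • (X ^ 2)⁻¹ • s ∉ A := fun j => by
      induction j with
      | zero =>
        have : q⁻¹ ^ (0 + 1) • (X ^ 2)⁻¹ • s = n • X⁻¹ • n⁻¹ • X⁻¹ • s := by
          simp only [hq, ← mul_smul]
          congr 1
          group
        rw [this]
        exact hn _ (h1' _ (hn' _ (h1' s hs)))
      | succ j ih => rw [pow_succ', mul_smul]; exact hqA' _ ih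
    rw [zpow_neg, zpow_natCast, ← inv_pow]
    exact h2 _ (key m)

/-- The group satisfies the ping-pong property on `S`: for every finite set of non-trivial elements
there are `A` and `X` such that `X`, `X⁻¹`, `X²`, `X⁻²` map the complement of `A` into `A`, while
the given elements map `A` into its complement. -/
def HasPingPong (G : Type u) (S : Type v) [Group G] [MulAction G S] : Prop :=
  ∀ C : Finset G, 1 ∉ C → ∃ (A : Set S) (X : G), A ≠ Set.univ ∧
    (∀ k ∈ ({1, -1, 2, -2} : Finset ℤ), ∀ s ∉ A, X ^ k • s ∈ A) ∧ ∀ c ∈ C, ∀ s ∈ A, c • s ∉ A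

theorem HasPingPong.exists_mem_evalWord_ne_one (hG : HasPingPong G S) {H : Subgroup G}
    (hnormal : H.Normal) (hH : H ≠ ⊥) {W : Set (Monoid.Coprod G (Multiplicative ℤ))}
    (hfin : W.Finite) (hW : ∀ w ∈ W, ∃ g, evalWord g w ≠ 1) :
    ∃ t ∈ H, ∀ w ∈ W, evalWord t w ≠ 1 := by
  classical
  obtain ⟨n, hnH, hn⟩ := H.bot_or_exists_ne_one.resolve_left hH
  have : ∀ w ∈ W, ∃ C : Finset G, 1 ∉ C ∧ ∀ (t : G) (A : Set S),
      (∀ n : ℤ, n ≠ 0 → ∀ s ∉ A, t ^ n • s ∈ A) → (∀ c ∈ C, ∀ s ∈ A, c • s ∉ A) →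
      A ≠ Set.univ → evalWord t w ≠ 1 := fun w hw => exists_finset_evalWord_ne_one (hW w hw)
  choose! C hC hCw using this
  obtain ⟨A, X, hA, hX, hc⟩ := hG (hfin.toFinset.biUnion C ∪ {n, n⁻¹}) (by
    simp only [Finset.mem_union, Finset.mem_biUnion, Set.Finite.mem_toFinset, Finset.mem_insert,
      Finset.mem_singleton, not_or, not_exists, not_and]
    exact ⟨hC, hn.symm, fun h => hn (by simpa using h.symm)⟩)
  refine ⟨X ^ 2 * (X⁻¹ * n * X * n⁻¹) * (X ^ 2)⁻¹, ?_, fun w hw => ?_⟩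
  · refine hnormal.conj_mem _ (H.mul_mem ?_ (H.inv_mem hnH)) _
    simpa using hnormal.conj_mem _ hnH X⁻¹
  · refine hCw w hw _ A (pingPong_conj_commutator hX (hc _ (by simp)) (hc _ (by simp)))
      (fun c h => hc c ?_) hA
    simp only [Finset.mem_union, Finset.mem_biUnion, Set.Finite.mem_toFinset]
    exact Or.inl ⟨w, hw, h⟩

theorem HasPingPong.eq_bot_or_eq_top (hG : HasPingPong G S) {H : Subgroup G}
    (hnormal : H.Normal) (hclosed : IsClosed[zariskiTopology G] (H : Set G)) :
    H = ⊥ ∨ H = ⊤ := by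
  by_contra! hH
  obtain ⟨x, hx⟩ : ∃ x, x ∉ H := by
    by_contra! h
    exact hH.2 (eq_top_iff.2 fun x _ => h x)
  let := zariskiTopology G
  obtain ⟨_, ⟨F, ⟨hF, hsub⟩, rfl⟩, hxF, hFH⟩ :=
    (TopologicalSpace.isTopologicalBasis_of_subbasis rfl).exists_subset_of_mem_open
      (show x ∈ (H : Set G)ᶜ from hx) hclosed.isOpen_compl
  choose! w hw using hsub
  obtain ⟨t, ht, hne⟩ := hG.exists_mem_evalWord_ne_one hnormal hH.1 (hF.image w) (by
    rintro _ ⟨V, hV, rfl⟩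
    refine ⟨x, ?_⟩
    have := hxF V hV
    rw [hw hV] at this
    exact this)
  refine hFH (Set.mem_sInter.2 fun V hV => ?_) ht
  rw [hw hV]
  exact hne _ ⟨V, hV, rfl⟩

end Words

/-! ### Gromov products of points -/

section GromovProduct

variable {S : Type v} [MetricSpace S]

theorem gromovProduct_add (o x s : S) :
    gromovProduct o x s + gromovProduct s x o = dist o s := by
  unfold gromovProduct
  rw [dist_comm s o]
  ring

theorem gromovProduct_nonneg (o x y : S) : 0 ≤ gromovProduct o x y := by
  unfold gromovProduct
  linarith [dist_triangle_right x y o]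

theorem gromovProduct_le_dist (o x y : S) : gromovProduct o x y ≤ dist o y := by
  linarith [gromovProduct_add o x y, gromovProduct_nonneg y x o]

theorem gromovProduct_self_right (o x : S) : gromovProduct o x o = 0 := by
  simp [gromovProduct]

theorem gromovProduct_le_add_dist (o o' x y : S) :
    gromovProduct o x y ≤ gromovProduct o' x y + dist o o' := by
  unfold gromovProduct
  linarith [dist_triangle_right x o o', dist_triangle_right y o o', dist_triangle x o' o,
    dist_triangle y o' o, dist_comm o o']

variable {G : Type u} [Group G] [MulAction G S] [IsIsometricSMul G S]

theorem gromovProduct_smul_left (g : G) (o x y : S) :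
    gromovProduct o (g • x) y = gromovProduct (g⁻¹ • o) x (g⁻¹ • y) := by
  rw [← gromovProduct_smul g (g⁻¹ • o)]
  simp

theorem dist_smul_inv (g : G) (o : S) : dist o (g⁻¹ • o) = dist o (g • o) := by
  rw [← dist_smul g o, smul_inv_smul, dist_comm]

theorem gromovProduct_inv_smul_le (g : G) (o x : S) :
    gromovProduct o x (g⁻¹ • x) ≤ gromovProduct o x (g • x) + dist o (g • o) := by
  rw [gromovProduct_comm, gromovProduct_smul_left, inv_inv]
  linarith [gromovProduct_le_add_dist (g • o) o x (g • x), dist_comm o (g • o)]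

theorem gromovProduct_smul_smul_le (g : G) (o x y : S) :
    gromovProduct o (g • x) (g • y) ≤ gromovProduct o x y + dist o (g • o) := by
  rw [gromovProduct_smul_left, inv_smul_smul, ← dist_smul_inv]
  linarith [gromovProduct_le_add_dist (g⁻¹ • o) o x y, dist_comm o (g⁻¹ • o)]

/-- The four point condition with constant `δ`. -/
def FourPoint (S : Type v) [MetricSpace S] (δ : ℝ) : Prop :=
  ∀ o x z y : S, min (gromovProduct o x z) (gromovProduct o z y) - δ ≤ gromovProduct o x y

theorem exists_fourPoint (S : Type v) [MetricSpace S] [IsHyperbolicSpace S] :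
    ∃ δ : ℝ, 0 ≤ δ ∧ FourPoint S δ := by
  obtain ⟨δ, h⟩ := IsHyperbolicSpace.exists_delta (S := S)
  exact ⟨max δ 0, le_max_right _ _, fun o x z y => by linarith [h x y z o, le_max_left δ 0]⟩

variable {δ : ℝ}

theorem FourPoint.le (h : FourPoint S δ) {o x y : S} (z : S) {r : ℝ}
    (hx : r ≤ gromovProduct o x z) (hy : r ≤ gromovProduct o z y) :
    r - δ ≤ gromovProduct o x y := by
  linarith [h o x z y, le_min hx hy]

theorem FourPoint.le_of_lt (h : FourPoint S δ) {o x y : S} (z : S) {r : ℝ}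
    (hx : r + δ < gromovProduct o x z) (hy : gromovProduct o x y ≤ r) :
    gromovProduct o z y ≤ r + δ := by
  by_contra! hlt
  have := lt_min hx hlt
  linarith [h o x z y]

/-- An isometry `g` that moves `o` far along the direction of `a` and `g⁻¹` along that of `b`
moves every point not in the direction of `b` to the direction of `a`. -/
theorem FourPoint.le_smul (h : FourPoint S δ) (hδ : 0 ≤ δ) {g : G} {o a b s : S} {T r : ℝ}
    (ha : T ≤ gromovProduct o a (g • o)) (hb : T ≤ gromovProduct o b (g⁻¹ • o))
    (hs : gromovProduct o b s ≤ r) (hr : 0 ≤ r) (hT : r + δ < T) :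
    T - r - 2 * δ ≤ gromovProduct o a (g • s) := by
  have h1 : gromovProduct o s (g⁻¹ • o) ≤ r + δ := by
    rw [gromovProduct_comm]
    exact h.le_of_lt _ (by linarith) hs
  have h2 := gromovProduct_add o (g • s) (g • o)
  have h3 := gromovProduct_smul g o s (g⁻¹ • o)
  rw [smul_inv_smul] at h3
  have h4 := ha.trans (gromovProduct_le_dist _ _ _)
  rw [gromovProduct_comm o (g • s)] at h2
  have := h.le (o := o) (x := a) (y := g • s) (g • o) (r := T - r - δ) (by linarith) (by linarith)
  linarith

/-- Think of `a`, `b` as points close to two fixed points at infinity. The products of `a`, `b` with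
their translates are large, so `g⁻¹ • a` and `g⁻¹ • b` still diverge at `o`. Hence `a` and `b`
diverge at `g • o`, and `o` cannot share the direction of both. -/
theorem FourPoint.le_or_le_of_smul (h : FourPoint S δ) {g : G} {o a b : S} {D : ℝ}
    (hδ : 0 ≤ δ) (hab : gromovProduct o a b ≤ D)
    (ha : D + 4 * δ < gromovProduct o a (g⁻¹ • a)) (hb : D + 4 * δ < gromovProduct o b (g⁻¹ • b)) :
    gromovProduct (g • o) a o ≤ D + 3 * δ ∨ gromovProduct (g • o) b o ≤ D + 3 * δ := by
  have h1 := h.le_of_lt (g⁻¹ • a) (by linarith) hab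
  rw [gromovProduct_comm] at h1
  have h2 := h.le_of_lt (g⁻¹ • b) (by linarith) h1
  rw [← gromovProduct_smul g, smul_inv_smul, smul_inv_smul] at h2
  have h3 := h (g • o) b o a
  by_contra! hlt
  have := lt_min hlt.2 (hlt.1.trans_eq (gromovProduct_comm _ _ _))
  linarith

/-- Here `g • o` lies towards `a`. Translating by `g⁻¹`, the point `g⁻¹ • o` does not lie towards
`g⁻¹ • a`, hence not towards `a`; as the displacement is large, the dichotomy for `g⁻¹` leaves only
`b`. -/
theorem FourPoint.le_and_le_of_smul (h : FourPoint S δ) (hδ : 0 ≤ δ) {g : G} {o a b : S} {D : ℝ}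
    (hab : gromovProduct o a b ≤ D)
    (ha : D + 4 * δ < gromovProduct o a (g • a)) (hb : D + 4 * δ < gromovProduct o b (g • b))
    (ha' : D + 4 * δ < gromovProduct o a (g⁻¹ • a))
    (hg : 2 * D + 7 * δ < dist o (g • o)) (hle : gromovProduct (g • o) a o ≤ D + 3 * δ) :
    dist o (g • o) - D - 3 * δ ≤ gromovProduct o a (g • o) ∧
      dist o (g • o) - D - 3 * δ ≤ gromovProduct o b (g⁻¹ • o) := by
  have h1 := gromovProduct_add o a (g • o)
  have h2 := gromovProduct_add o b (g⁻¹ • o)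
  have h3 := gromovProduct_add o a (g⁻¹ • o)
  rw [dist_smul_inv] at h2 h3
  refine ⟨by linarith, ?_⟩
  rw [← gromovProduct_smul g⁻¹, inv_smul_smul] at hle
  have h4 := h.le_of_lt a (by rw [gromovProduct_comm]; linarith) hle
  rcases h.le_or_le_of_smul (g := g⁻¹) hδ hab (by rwa [inv_inv]) (by rwa [inv_inv]) with h5 | h5 <;>
    linarith

end GromovProduct

/-! ### Sequences converging at infinity -/

section Boundary

variable {S : Type v} [MetricSpace S] [IsHyperbolicSpace S]

theorem ConvSeq.limit_eq_iff {x y : ConvSeq S} :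
    x.limit = y.limit ↔ DivergesTogether x.1 y.1 :=
  Quotient.eq (r := convSeqSetoid S)

theorem Boundary.exists_limit_eq (a : Boundary S) : ∃ x : ConvSeq S, x.limit = a :=
  Quotient.exists_rep a

theorem ConvSeq.exists_le_of_limit_eq {x y : ConvSeq S} (h : x.limit = y.limit) (o : S) (B : ℝ) :
    ∃ N, ∀ i ≥ N, ∀ j ≥ N, B ≤ gromovProduct o (x.1 i) (y.1 j) :=
  divergesTogether_iff.1 (limit_eq_iff.1 h) o B

theorem ConvSeq.exists_le_of_limit_ne {x y : ConvSeq S} (h : x.limit ≠ y.limit) (o : S) :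
    ∃ D N, ∀ i ≥ N, ∀ j ≥ N, gromovProduct o (x.1 i) (y.1 j) ≤ D := by
  obtain ⟨δ, hδ, hS⟩ := exists_fourPoint S
  rw [Ne, limit_eq_iff, divergesTogether_iff] at h
  push Not at h
  obtain ⟨o', B, hB⟩ := h
  obtain ⟨N₁, h₁⟩ := exists_le_of_limit_eq (rfl : x.limit = x.limit) o (B + dist o o' + 2 * δ)
  obtain ⟨N₂, h₂⟩ := exists_le_of_limit_eq (rfl : y.limit = y.limit) o (B + dist o o' + 2 * δ)
  refine ⟨B + dist o o' + 2 * δ, max N₁ N₂, fun i hi j hj => ?_⟩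
  by_contra! hlt
  obtain ⟨i', hi', j', hj', hlt'⟩ := hB (max N₁ N₂)
  have e₁ := hS.le _ (h₁ i' (le_of_max_le_left hi') i (le_of_max_le_left hi)) hlt.le
  have e₂ := hS.le _ e₁ (le_trans (by linarith)
    (h₂ j (le_of_max_le_right hj) j' (le_of_max_le_right hj')))
  linarith [gromovProduct_le_add_dist o o' (x.1 i') (y.1 j')]

theorem eventually_lt_of_lt_extGromovProduct_point {o s : S} {x : ConvSeq S} {r : ℝ}
    (h : (r : EReal) < extGromovProduct o x.limit (.point s)) :
    ∀ᶠ i in atTop, r < gromovProduct o (x.1 i) s := by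
  have := h.trans_le ((iInf_le _ x).trans (iInf_le _ rfl))
  exact (eventually_lt_of_lt_liminf this).mono fun i hi => EReal.coe_lt_coe_iff.1 hi

theorem eventually_lt_of_lt_extGromovProduct_ideal {o : S} {x y : ConvSeq S} {r : ℝ}
    (h : (r : EReal) < extGromovProduct o x.limit (.ideal y.limit)) :
    ∃ N, ∀ i ≥ N, ∀ j ≥ N, r < gromovProduct o (x.1 i) (y.1 j) := by
  have := h.trans_le
    ((iInf_le _ x).trans ((iInf_le _ rfl).trans ((iInf_le _ y).trans (iInf_le _ rfl))))
  obtain ⟨N, hN⟩ := eventually_atTop_prod_self'.1 (eventually_lt_of_lt_liminf this)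
  exact ⟨N, fun i hi j hj => EReal.coe_lt_coe_iff.1 (hN i hi j hj)⟩

theorem le_extGromovProduct_point {o s : S} {a : Boundary S} {r : ℝ}
    (h : ∀ x : ConvSeq S, x.limit = a → ∀ᶠ i in atTop, r ≤ gromovProduct o (x.1 i) s) :
    (r : EReal) ≤ extGromovProduct o a (.point s) :=
  le_iInf₂ fun x hx => le_liminf_of_le (by isBoundedDefault)
    ((h x hx).mono fun _ hi => EReal.coe_le_coe_iff.2 hi)

theorem le_extGromovProduct_ideal {o : S} {a b : Boundary S} {r : ℝ}
    (h : ∀ x : ConvSeq S, x.limit = a → ∀ y : ConvSeq S, y.limit = b →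
      ∃ N, ∀ i ≥ N, ∀ j ≥ N, r ≤ gromovProduct o (x.1 i) (y.1 j)) :
    (r : EReal) ≤ extGromovProduct o a (.ideal b) :=
  le_iInf₂ fun x hx => le_iInf₂ fun y hy => le_liminf_of_le (by isBoundedDefault) (by
    obtain ⟨N, hN⟩ := h x hx y hy
    exact eventually_atTop_prod_self'.2
      ⟨N, fun i hi j hj => EReal.coe_le_coe_iff.2 (hN i hi j hj)⟩)

theorem mem_basicNhd_of_lt {r r' : ℝ} (h : r < r') {o : S} {a : Boundary S} {s : Bordification S}
    (hs : (r' : EReal) ≤ extGromovProduct o a s) : s ∈ basicNhd o a r :=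
  (EReal.coe_lt_coe_iff.2 h).trans_le hs

theorem FourPoint.mem_basicNhd_point {δ : ℝ} (hS : FourPoint S δ) {o s : S} {x : ConvSeq S}
    {r r' : ℝ} (hr : r + δ < r') (h : ∀ᶠ i in atTop, r' ≤ gromovProduct o (x.1 i) s) :
    .point s ∈ basicNhd o x.limit r := by
  refine mem_basicNhd_of_lt (r' := r' - δ) (by linarith) (le_extGromovProduct_point fun y hy => ?_)
  obtain ⟨N, hN⟩ := ConvSeq.exists_le_of_limit_eq hy o r'
  obtain ⟨M, hM⟩ := eventually_atTop.1 h
  filter_upwards [eventually_ge_atTop (max N M)] with i hi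
  exact hS.le _ (hN i (le_of_max_le_left hi) i (le_of_max_le_left hi))
    (hM i (le_of_max_le_right hi))

theorem FourPoint.mem_basicNhd_trans {δ : ℝ} (hS : FourPoint S δ) {o : S} {a b : Boundary S}
    {s : Bordification S} {r r' : ℝ} (hr : r + δ < r') (hb : .ideal b ∈ basicNhd o a r')
    (hs : s ∈ basicNhd o b r') : s ∈ basicNhd o a r := by
  obtain ⟨y, rfl⟩ := b.exists_limit_eq
  cases s with
  | point s =>
    refine mem_basicNhd_of_lt (r' := r' - δ) (by linarith)
      (le_extGromovProduct_point fun x hx => ?_)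
    subst hx
    obtain ⟨N, hN⟩ := eventually_lt_of_lt_extGromovProduct_ideal hb
    obtain ⟨M, hM⟩ := eventually_atTop.1 (eventually_lt_of_lt_extGromovProduct_point hs)
    filter_upwards [eventually_ge_atTop (max N M)] with i hi
    exact hS.le _ (hN i (le_of_max_le_left hi) i (le_of_max_le_left hi)).le
      (hM i (le_of_max_le_right hi)).le
  | ideal c =>
    refine mem_basicNhd_of_lt (r' := r' - δ) (by linarith)
      (le_extGromovProduct_ideal fun x hx z hz => ?_)
    subst hx hz
    obtain ⟨N, hN⟩ := eventually_lt_of_lt_extGromovProduct_ideal hb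
    obtain ⟨M, hM⟩ := eventually_lt_of_lt_extGromovProduct_ideal hs
    refine ⟨max N M, fun i hi j hj => ?_⟩
    exact hS.le (y.1 (max N M)) (hN i (le_of_max_le_left hi) _ (le_max_left _ _)).le
      (hM _ (le_max_right _ _) j (le_of_max_le_right hj)).le

/-! ### Topology of the bordification and of the boundary. -/

theorem basicNhd_subset (o o' : S) (a : Boundary S) (r : ℝ) :
    ∃ r', basicNhd o' a r' ⊆ basicNhd o a r := by
  refine ⟨r + 1 + dist o o', fun s hs => mem_basicNhd_of_lt (r' := r + 1) (by linarith) ?_⟩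
  cases s with
  | point s =>
    refine le_extGromovProduct_point fun x hx => ?_
    subst hx
    filter_upwards [eventually_lt_of_lt_extGromovProduct_point hs] with i hi
    linarith [gromovProduct_le_add_dist o' o (x.1 i) s, dist_comm o o']
  | ideal b =>
    refine le_extGromovProduct_ideal fun x hx y hy => ?_
    subst hx hy
    obtain ⟨N, hN⟩ := eventually_lt_of_lt_extGromovProduct_ideal hs
    refine ⟨N, fun i hi j hj => ?_⟩
    linarith [hN i hi j hj, gromovProduct_le_add_dist o' o (x.1 i) (y.1 j), dist_comm o o']

theorem isOpen_point_preimage_basicNhd (o : S) (a : Boundary S) (r : ℝ) :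
    IsOpen (Bordification.point ⁻¹' basicNhd o a r) := by
  refine Metric.isOpen_iff.2 fun s hs => ?_
  obtain ⟨r', hr, hr'⟩ := EReal.lt_iff_exists_real_btwn.1 (show (r : EReal) < _ from hs)
  have hr := EReal.coe_lt_coe_iff.1 hr
  refine ⟨(r' - r) / 2, by linarith, fun t ht => ?_⟩
  rw [Metric.mem_ball] at ht
  refine mem_basicNhd_of_lt (r' := r' - (r' - r) / 2) (by linarith)
    (le_extGromovProduct_point fun x hx => ?_)
  subst hx
  filter_upwards [eventually_lt_of_lt_extGromovProduct_point hr'] with i hi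
  unfold gromovProduct at hi ⊢
  linarith [dist_triangle_left s o t, dist_triangle (x.1 i) s t, dist_comm s t]

/-- Every basic neighbourhood of a boundary point contains an open set around that point. -/
theorem exists_isOpen_subset_basicNhd (o : S) (a : Boundary S) (r : ℝ) :
    ∃ V : Set (Bordification S), IsOpen V ∧ .ideal a ∈ V ∧ V ⊆ basicNhd o a r := by
  obtain ⟨δ, hδ, hS⟩ := exists_fourPoint S
  have hself : ∀ (b : Boundary S) (t : ℝ), .ideal b ∈ basicNhd o b t := fun b t =>
    mem_basicNhd_of_lt (lt_add_one t) (le_extGromovProduct_ideal fun x hx y hy =>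
      ConvSeq.exists_le_of_limit_eq (hx.trans hy.symm) o _)
  -- Only those ideal points are kept around which a whole basic neighbourhood stays inside; the
  -- extra `δ + 1` used below pays for `FourPoint.mem_basicNhd_trans`.
  refine ⟨{s | s ∈ basicNhd o a r ∧ ∀ b, s = .ideal b → ∃ t, basicNhd o b t ⊆ basicNhd o a r},
    ⟨?_, fun b hb o' => ?_⟩, ⟨hself a r, fun b hb => ?_⟩, fun s hs => hs.1⟩
  · simpa [Set.preimage] using isOpen_point_preimage_basicNhd o a r
  · obtain ⟨t, ht⟩ := hb.2 b rfl
    obtain ⟨t', ht'⟩ := basicNhd_subset o o' b (max t (t + δ + 1))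
    refine ⟨t', fun s hs => ?_⟩
    have hs := ht' hs
    refine ⟨ht (basicNhd_anti o b (le_max_left _ _) hs), ?_⟩
    rintro c rfl
    refine ⟨t + δ + 1, fun s hsc => ht ?_⟩
    exact hS.mem_basicNhd_trans (by linarith) (basicNhd_anti o b (le_max_right _ _) hs) hsc
  · cases hb
    exact ⟨r, subset_rfl⟩

/-- A point close to both limits would force their Gromov product above its bound `D`. Separation
makes the fixed point sets of group elements closed. -/
instance : T2Space (Boundary S) where
  t2 a b hab := by
    obtain ⟨x, rfl⟩ := a.exists_limit_eq
    obtain ⟨y, rfl⟩ := b.exists_limit_eq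
    obtain ⟨δ, hδ, hS⟩ := exists_fourPoint S
    have o := x.1 0
    obtain ⟨D, N, hD⟩ := ConvSeq.exists_le_of_limit_ne hab o
    obtain ⟨U, hU, hxU, hUr⟩ := exists_isOpen_subset_basicNhd o x.limit (D + δ)
    obtain ⟨V, hV, hyV, hVr⟩ := exists_isOpen_subset_basicNhd o y.limit (D + δ)
    refine ⟨Bordification.ideal ⁻¹' U, Bordification.ideal ⁻¹' V, hU.preimage continuous_induced_dom,
      hV.preimage continuous_induced_dom, hxU, hyV, Set.disjoint_left.2 fun c hcU hcV => ?_⟩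
    obtain ⟨z, rfl⟩ := c.exists_limit_eq
    obtain ⟨N₁, h₁⟩ := eventually_lt_of_lt_extGromovProduct_ideal (hUr hcU)
    obtain ⟨N₂, h₂⟩ := eventually_lt_of_lt_extGromovProduct_ideal (hVr hcV)
    obtain ⟨n, hn, hn₁, hn₂⟩ : ∃ n, N ≤ n ∧ N₁ ≤ n ∧ N₂ ≤ n :=
      ⟨max N (max N₁ N₂), by simp⟩
    have e₁ := h₁ n hn₁ n hn₁
    have e₂ := hS.le_of_lt _ e₁ (hD n hn n hn)
    rw [gromovProduct_comm] at e₂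
    linarith [h₂ n hn₂ n hn₂]

end Boundary

/-! ### Dynamics of the action -/

section Dynamics

theorem exists_dist_gt_of_not_isBounded {G : Type u} {S : Type v} [Group G] [MetricSpace S]
    [MulAction G S] {H : Subgroup G} {o : S}
    (h : ¬ Bornology.IsBounded (MulAction.orbit H o)) (r : ℝ) : ∃ g ∈ H, r < dist o (g • o) := by
  by_contra! hle
  refine h ((Metric.isBounded_iff_subset_closedBall o).2 ⟨r, ?_⟩)
  rintro _ ⟨g, rfl⟩
  rw [Metric.mem_closedBall, dist_comm]
  exact hle g g.2

variable {G : Type u} {S : Type v} [Group G] [MetricSpace S] [MulAction G S] [IsIsometricSMul G S]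

/-- As `s` is away from `a` and `b`, `u` sends it towards `a` and `u⁻¹` towards `b`, so both images
diverge from `s` and from each other. Applying `u` to the pair `u⁻¹ • s`, `u • s` handles `u²` at
the cost of one displacement of `u`; inverting `u²` costs two more. -/
theorem FourPoint.zpow_smul_le {δ : ℝ} (hS : FourPoint S δ) (hδ : 0 ≤ δ) {u : G} {o a b s : S}
    {M T : ℝ} (hT : 2 * M + 4 * δ < T) (hab : gromovProduct o a b ≤ M)
    (ha : T ≤ gromovProduct o a (u • o)) (hb : T ≤ gromovProduct o b (u⁻¹ • o))
    (has : gromovProduct o a s ≤ M) (hbs : gromovProduct o b s ≤ M) :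
    ∀ k ∈ ({1, -1, 2, -2} : Finset ℤ),
      gromovProduct o s (u ^ k • s) ≤ M + 2 * δ + 3 * dist o (u • o) := by
  have hM := (gromovProduct_nonneg o a b).trans hab
  have hd := dist_nonneg (x := o) (y := u • o)
  have e₁ := hS.le_smul hδ ha hb hbs hM (by linarith)
  have e₂ := hS.le_smul (g := u⁻¹) hδ hb (by rwa [inv_inv]) has hM (by linarith)
  have h₁ := hS.le_of_lt _ (by linarith) has
  rw [gromovProduct_comm] at h₁
  have h₁' := gromovProduct_inv_smul_le u o s
  have h₂ := hS.le_of_lt _ (by linarith) hab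
  rw [gromovProduct_comm] at h₂
  have h₂ := hS.le_of_lt (u⁻¹ • s) (by linarith) h₂
  have h₃ := gromovProduct_smul_smul_le u o (u⁻¹ • s) (u • s)
  rw [smul_inv_smul, smul_smul, ← pow_two] at h₃
  have h₃' := gromovProduct_inv_smul_le (u ^ 2) o s
  have h₄ : dist o (u ^ 2 • o) ≤ 2 * dist o (u • o) := by
    have := dist_triangle o (u • o) (u • u • o)
    rw [dist_smul] at this
    rw [pow_two, mul_smul]
    linarith
  intro k hk
  simp only [Finset.mem_insert, Finset.mem_singleton] at hk
  rcases hk with rfl | rfl | rfl | rfl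
  · rw [zpow_one]; linarith
  · rw [zpow_neg_one]; linarith
  · rw [show u ^ (2 : ℤ) = u ^ 2 from zpow_natCast u 2]; linarith
  · rw [zpow_neg, show u ^ (2 : ℤ) = u ^ 2 from zpow_natCast u 2]; linarith

/-- The points whose Gromov product with the limit of `z` is larger than `r`. -/
def shadow (o : S) (z : ConvSeq S) (r : ℝ) : Set S :=
  {s | ∀ᶠ i in atTop, r < gromovProduct o (z.1 i) s}

theorem FourPoint.smul_mem_shadow {δ : ℝ} (hS : FourPoint S δ) (hδ : 0 ≤ δ) {g : G} {o : S}
    {z : ConvSeq S} {r T : ℝ} (hr : 0 ≤ r) (hT : 2 * r + 3 * δ < T)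
    (hg : ∀ᶠ i in atTop, T ≤ gromovProduct o (z.1 i) (g • o))
    (hg' : ∀ᶠ i in atTop, T ≤ gromovProduct o (z.1 i) (g⁻¹ • o)) {s : S}
    (hs : s ∉ shadow o z r) : g • s ∈ shadow o z r := by
  have hs : ∃ᶠ i in atTop, gromovProduct o (z.1 i) s ≤ r := by
    simpa only [shadow, Set.mem_ofPred_eq, not_eventually, not_lt] using hs
  obtain ⟨i, hi, hi'⟩ := (hs.and_eventually hg').exists
  filter_upwards [hg] with j hj
  have := hS.le_smul hδ hj hi' hi hr (by linarith)
  linarith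

variable [IsHyperbolicSpace S]

/-- If `⟨f⟩` has unbounded orbits and `f` fixes two points of the boundary, then the powers of `f`
move `o` far towards one point, while their inverses move it towards the other point. -/
theorem exists_smul_towards {f : G} {o : S}
    (hf : ¬ Bornology.IsBounded (MulAction.orbit (Subgroup.zpowers f) o)) {x y : ConvSeq S}
    (hx : f • x.limit = x.limit) (hy : f • y.limit = y.limit) (hne : x.limit ≠ y.limit)
    (T : ℝ) (N : ℕ) : ∃ (g : G) (i : ℕ), N ≤ i ∧ T ≤ gromovProduct o (x.1 i) (g • o) ∧
      T ≤ gromovProduct o (y.1 i) (g⁻¹ • o) := by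
  obtain ⟨δ, hδ, hS⟩ := exists_fourPoint S
  obtain ⟨D, N₀, hD⟩ := ConvSeq.exists_le_of_limit_ne hne o
  obtain ⟨g, hg, hdist⟩ := exists_dist_gt_of_not_isBounded hf
    (max (2 * D + 7 * δ) (T + D + 3 * δ))
  obtain ⟨hdist, hdist'⟩ := max_lt_iff.1 hdist
  have hfix : ∀ z : ConvSeq S, f • z.limit = z.limit → ∀ e ∈ Subgroup.zpowers f,
      ∃ n, ∀ i ≥ n, D + 4 * δ < gromovProduct o (z.1 i) (e • z.1 i) := fun z hz e he => by
    have : Subgroup.zpowers f ≤ MulAction.stabilizer G z.limit := by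
      rwa [Subgroup.zpowers_le, MulAction.mem_stabilizer_iff]
    obtain ⟨n, hn⟩ := ConvSeq.exists_le_of_limit_eq (x := z) (y := e • z) (this he).symm o
      (D + 4 * δ + 1)
    exact ⟨n, fun i hi => (lt_add_one _).trans_le (hn i hi i hi)⟩
  obtain ⟨n₁, h₁⟩ := hfix x hx g hg
  obtain ⟨n₂, h₂⟩ := hfix y hy g hg
  obtain ⟨n₃, h₃⟩ := hfix x hx g⁻¹ (inv_mem hg)
  obtain ⟨n₄, h₄⟩ := hfix y hy g⁻¹ (inv_mem hg)
  obtain ⟨i, hN, hN₀, hi₁, hi₂, hi₃, hi₄⟩ :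
      ∃ i, N ≤ i ∧ N₀ ≤ i ∧ n₁ ≤ i ∧ n₂ ≤ i ∧ n₃ ≤ i ∧ n₄ ≤ i :=
    ⟨N + N₀ + n₁ + n₂ + n₃ + n₄, by omega, by omega, by omega, by omega, by omega, by omega⟩
  have hab := hD i hN₀ i hN₀
  -- If `g` moves `o` towards the second point, `g⁻¹` is the required element.
  rcases hS.le_or_le_of_smul hδ hab (h₃ i hi₃) (h₄ i hi₄) with hle | hle
  · have := hS.le_and_le_of_smul hδ hab (h₁ i hi₁) (h₂ i hi₂) (h₃ i hi₃) hdist hle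
    exact ⟨g, i, hN, by linarith, by linarith⟩
  · rw [gromovProduct_comm] at hab
    have := hS.le_and_le_of_smul hδ hab (h₂ i hi₂) (h₁ i hi₁) (h₄ i hi₄) hdist hle
    exact ⟨g⁻¹, i, hN, by linarith, by rw [inv_inv]; linarith⟩

theorem IsLoxodromic.exists_limit {f : G} (hf : IsLoxodromic S f) : ∃ x y : ConvSeq S,
    x.limit ≠ y.limit ∧ MulAction.fixedBy (Boundary S) f = {x.limit, y.limit} := by
  obtain ⟨a, b, hab, hfix⟩ := Set.encard_eq_two.1 hf.2
  obtain ⟨x, rfl⟩ := a.exists_limit_eq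
  obtain ⟨y, rfl⟩ := b.exists_limit_eq
  exact ⟨x, y, hab, hfix⟩

/-- In an action of general type, every point `s` is moved away from itself, as seen from `o`, by an
element `u` together with `u⁻¹`, `u²` and `u⁻²`. -/
theorem IsGeneralType.exists_zpow_smul_le (hG : IsGeneralType G S) (o : S) :
    ∃ L : ℝ, ∀ s : S, ∃ u : G, ∀ k ∈ ({1, -1, 2, -2} : Finset ℤ),
      gromovProduct o s (u ^ k • s) ≤ L := by
  obtain ⟨-, f, g, hf, hg, hfg⟩ := hG
  obtain ⟨δ, hδ, hS⟩ := exists_fourPoint S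
  obtain ⟨x, y, hxy, hfix⟩ := hf.exists_limit
  obtain ⟨z, w, hzw, hfix'⟩ := hg.exists_limit
  have hx : x.limit ∈ MulAction.fixedBy (Boundary S) f := hfix ▸ Or.inl rfl
  have hy : y.limit ∈ MulAction.fixedBy (Boundary S) f := hfix ▸ Or.inr rfl
  have hz : z.limit ∈ MulAction.fixedBy (Boundary S) g := hfix' ▸ Or.inl rfl
  have hw : w.limit ∈ MulAction.fixedBy (Boundary S) g := hfix' ▸ Or.inr rfl
  obtain ⟨D₁, n₁, h₁⟩ := ConvSeq.exists_le_of_limit_ne hxy o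
  obtain ⟨D₂, n₂, h₂⟩ := ConvSeq.exists_le_of_limit_ne hzw o
  obtain ⟨D₃, n₃, h₃⟩ := ConvSeq.exists_le_of_limit_ne (hfg.ne_of_mem hx hz) o
  obtain ⟨D₄, n₄, h₄⟩ := ConvSeq.exists_le_of_limit_ne (hfg.ne_of_mem hx hw) o
  obtain ⟨D₅, n₅, h₅⟩ := ConvSeq.exists_le_of_limit_ne (hfg.ne_of_mem hy hz) o
  obtain ⟨D₆, n₆, h₆⟩ := ConvSeq.exists_le_of_limit_ne (hfg.ne_of_mem hy hw) o
  obtain ⟨D, hD₁, hD₂, hD₃, hD₄, hD₅, hD₆⟩ :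
      ∃ D, D₁ ≤ D ∧ D₂ ≤ D ∧ D₃ ≤ D ∧ D₄ ≤ D ∧ D₅ ≤ D ∧ D₆ ≤ D :=
    ⟨max D₁ (max D₂ (max D₃ (max D₄ (max D₅ D₆)))), by simp⟩
  -- If `s` had product above `M` with a point near a fixed point of `f` and with one near a fixed
  -- point of `g`, these two would have product at least `M - δ > D`. So `s` avoids both ends of `f`
  -- or both ends of `g`, and two elements `u`, `v` serve all `s`.
  set M := D + δ + 1 with hM
  obtain ⟨u, i, hi, hux, huy⟩ := exists_smul_towards (hf.1 o) hx hy hxy (2 * M + 4 * δ + 1)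
    (n₁ + n₃ + n₄ + n₅ + n₆)
  obtain ⟨v, j, hj, hvz, hvw⟩ := exists_smul_towards (hg.1 o) hz hw hzw (2 * M + 4 * δ + 1)
    (n₂ + n₃ + n₄ + n₅ + n₆)
  have e₁ := h₁ i (by omega) i (by omega)
  have e₂ := h₂ j (by omega) j (by omega)
  have e₃ := h₃ i (by omega) j (by omega)
  have e₄ := h₄ i (by omega) j (by omega)
  have e₅ := h₅ i (by omega) j (by omega)
  have e₆ := h₆ i (by omega) j (by omega)
  refine ⟨M + 2 * δ + 3 * max (dist o (u • o)) (dist o (v • o)), fun s => ?_⟩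
  by_cases hs : gromovProduct o (x.1 i) s ≤ M ∧ gromovProduct o (y.1 i) s ≤ M
  · refine ⟨u, fun k hk => ?_⟩
    have := hS.zpow_smul_le hδ (by linarith) (by linarith) hux huy hs.1 hs.2 k hk
    linarith [le_max_left (dist o (u • o)) (dist o (v • o))]
  by_cases ht : gromovProduct o (z.1 j) s ≤ M ∧ gromovProduct o (w.1 j) s ≤ M
  · refine ⟨v, fun k hk => ?_⟩
    have := hS.zpow_smul_le hδ (by linarith) (by linarith) hvz hvw ht.1 ht.2 k hk
    linarith [le_max_right (dist o (u • o)) (dist o (v • o))]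
  have key : ∀ a b : S, M < gromovProduct o a s → M < gromovProduct o b s →
      D + 1 ≤ gromovProduct o a b := fun a b ha hb => by
    have := hS.le s ha.le (hb.le.trans_eq (gromovProduct_comm _ _ _))
    linarith
  rw [not_and_or, not_le, not_le] at hs ht
  rcases hs with hs | hs <;> rcases ht with ht | ht <;> linarith [key _ _ hs ht]

/-! ### The limit set -/

theorem exists_le_of_mem_limitSet {z : ConvSeq S} (hz : z.limit ∈ limitSet G S) :
    ∃ o : S, ∀ r : ℝ, ∃ g : G, ∀ᶠ i in atTop, r ≤ gromovProduct o (z.1 i) (g • o) := by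
  obtain ⟨o, ho⟩ := hz
  refine ⟨o, fun r => ?_⟩
  obtain ⟨V, hV, hzV, hVr⟩ := exists_isOpen_subset_basicNhd o z.limit r
  obtain ⟨_, hV', _, ⟨g, rfl⟩, rfl⟩ := mem_closure_iff.1 ho V hV hzV
  exact ⟨g, (eventually_lt_of_lt_extGromovProduct_point (hVr hV')).mono fun _ => le_of_lt⟩

theorem mem_limitSet_of_forall_exists_le {z : ConvSeq S} {o : S}
    (h : ∀ r : ℝ, ∃ g : G, ∀ᶠ i in atTop, r ≤ gromovProduct o (z.1 i) (g • o)) :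
    z.limit ∈ limitSet G S := by
  obtain ⟨δ, hδ, hS⟩ := exists_fourPoint S
  refine ⟨o, mem_closure_iff.2 fun V hV hzV => ?_⟩
  obtain ⟨r, hr⟩ := hV.2 _ hzV o
  obtain ⟨g, hg⟩ := h (r + δ + 1)
  exact ⟨_, hr (hS.mem_basicNhd_point (lt_add_one _) hg), _, ⟨g, rfl⟩, rfl⟩

theorem IsGeneralType.nonempty_limitSet (hG : IsGeneralType G S) : Nonempty (limitSet G S) := by
  obtain ⟨-, f, -, hf, -⟩ := hG
  obtain ⟨δ, hδ, hS⟩ := exists_fourPoint S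
  obtain ⟨x, y, hxy, hfix⟩ := hf.exists_limit
  have hx : x.limit ∈ MulAction.fixedBy (Boundary S) f := hfix ▸ Or.inl rfl
  have hy : y.limit ∈ MulAction.fixedBy (Boundary S) f := hfix ▸ Or.inr rfl
  have o := x.1 0
  refine ⟨x.limit, mem_limitSet_of_forall_exists_le (o := o) fun r => ?_⟩
  obtain ⟨N, hN⟩ := ConvSeq.exists_le_of_limit_eq (rfl : x.limit = x.limit) o (r + δ)
  obtain ⟨g, i, hi, hg, -⟩ := exists_smul_towards (hf.1 o) hx hy hxy (r + δ) N
  refine ⟨g, eventually_atTop.2 ⟨N, fun j hj => ?_⟩⟩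
  have := hS.le _ (hN j hj i hi) hg
  linarith

instance : ContinuousConstSMul G (limitSet G S) where
  continuous_const_smul g := by
    refine Continuous.subtype_mk (f := fun a : limitSet G S => g • (a : Boundary S)) ?_ _
    have h₁ : Continuous fun a : limitSet G S => Bordification.ideal (a : Boundary S) :=
      continuous_induced_dom.comp continuous_subtype_val
    exact continuous_induced_rng.2 (h₁.const_smul g)

/-- A finite union of closed sets with empty interior has empty interior, so it does not cover the
non-empty limit set. -/
theorem exists_forall_smul_ne (hG : IsGeneralType G S)
    (hfree : IsTopologicallyFree G (limitSet G S)) {C : Finset G} (hC : 1 ∉ C) :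
    ∃ a : Boundary S, a ∈ limitSet G S ∧ ∀ c ∈ C, c • a ≠ a := by
  classical
  have : interior (⋃ c ∈ C, MulAction.fixedBy (limitSet G S) c) = ∅ := by
    induction C using Finset.induction_on with
    | empty => simp
    | insert c C _ ih =>
      rw [Finset.mem_insert, not_or] at hC
      rw [Finset.set_biUnion_insert, interior_union_isClosed_of_interior_empty _ (ih hC.2)]
      · exact hfree c (Ne.symm hC.1)
      · exact isClosed_eq (continuous_const_smul c) continuous_id
  obtain ⟨a, ha⟩ : ∃ a, a ∉ ⋃ c ∈ C, MulAction.fixedBy (limitSet G S) c := by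
    by_contra! h
    have hne := hG.nonempty_limitSet
    rw [Set.eq_univ_of_forall h, interior_univ] at this
    exact Set.univ_nonempty.ne_empty this
  simp only [Set.mem_iUnion, not_exists, MulAction.mem_fixedBy] at ha
  exact ⟨a, a.2, fun c hc h => ha c hc (Subtype.ext h)⟩

/-! ### Ping-pong near a limit point -/

/-- If `s` and `g • s` both lie in a deep shadow, then `g • s` is close to the limit of `z` and, up
to the displacement of `g`, to its translate; these would then have a large product. -/
theorem eventually_forall_smul_notMem_shadow {g : G} {o : S} {z : ConvSeq S}
    (hg : g • z.limit ≠ z.limit) :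
    ∀ᶠ r in atTop, ∀ s ∈ shadow o z r, g • s ∉ shadow o z r := by
  obtain ⟨δ, hδ, hS⟩ := exists_fourPoint S
  obtain ⟨D, N, hD⟩ := ConvSeq.exists_le_of_limit_ne (x := g • z) hg o
  filter_upwards [eventually_ge_atTop (D + δ + dist o (g • o))] with r hr s hs hgs
  obtain ⟨i, ⟨hi, hi'⟩, hiN⟩ :=
    ((Eventually.and hs hgs).and (eventually_ge_atTop N)).exists
  have e₁ : gromovProduct o (g • z.1 i) (z.1 i) ≤ D := hD i hiN i hiN
  have e₂ := gromovProduct_smul_smul_le g⁻¹ o (g • z.1 i) (g • s)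
  rw [inv_smul_smul, inv_smul_smul, dist_smul_inv] at e₂
  have e₃ := hS o (g • z.1 i) (g • s) (z.1 i)
  rw [gromovProduct_comm o (g • s)] at e₃
  have := lt_min (a := r - dist o (g • o)) (b := gromovProduct o (g • z.1 i) (g • s))
    (c := gromovProduct o (z.1 i) (g • s)) (by linarith)
    (by linarith [dist_nonneg (x := o) (y := g • o)])
  linarith

/-- Choose `g • o` far towards the limit of `z`, and `u` whose powers move `g⁻¹ • o` to points
diverging from it at `o`. Translated by `g`, the powers of `X = g u g⁻¹` send `o` to points
diverging from `o` at `g • o`, so seen from `o` they lie behind `g • o`. The bound `L` is uniform in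
the moved point, so `g` can be chosen before `u`. -/
theorem IsGeneralType.exists_zpow_smul_towards (hG : IsGeneralType G S) {o : S} {z : ConvSeq S}
    (hz : ∀ r : ℝ, ∃ g : G, ∀ᶠ i in atTop, r ≤ gromovProduct o (z.1 i) (g • o)) (T : ℝ) :
    ∃ X : G, ∀ k ∈ ({1, -1, 2, -2} : Finset ℤ),
      ∀ᶠ i in atTop, T ≤ gromovProduct o (z.1 i) (X ^ k • o) := by
  obtain ⟨δ, hδ, hS⟩ := exists_fourPoint S
  obtain ⟨L, hL⟩ := hG.exists_zpow_smul_le o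
  obtain ⟨g, hg⟩ := hz (T + δ + max L 0)
  obtain ⟨u, hu⟩ := hL (g⁻¹ • o)
  refine ⟨g * u * g⁻¹, fun k hk => ?_⟩
  have huk := hu k hk
  filter_upwards [hg] with i hi
  have e₁ := hi.trans (gromovProduct_le_dist _ _ _)
  have e₂ := gromovProduct_add o ((g * u * g⁻¹) ^ k • o) (g • o)
  have e₃ : gromovProduct (g • o) ((g * u * g⁻¹) ^ k • o) o ≤ L := by
    rw [← gromovProduct_smul g, gromovProduct_comm, smul_inv_smul] at huk
    rwa [conj_zpow, mul_smul, mul_smul]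
  have := hS.le (o := o) (x := z.1 i) (y := (g * u * g⁻¹) ^ k • o) (g • o) (r := T + δ)
    (by linarith [le_max_right L 0])
    (by rw [gromovProduct_comm]; linarith [le_max_left L 0])
  linarith

theorem IsGeneralType.hasPingPong (hG : IsGeneralType G S)
    (hfree : IsTopologicallyFree G (limitSet G S)) : HasPingPong G S := by
  intro C hC
  obtain ⟨a, ha, hCa⟩ := exists_forall_smul_ne hG hfree hC
  obtain ⟨z, rfl⟩ := a.exists_limit_eq
  obtain ⟨o, ho⟩ := exists_le_of_mem_limitSet ha
  obtain ⟨δ, hδ, hS⟩ := exists_fourPoint S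
  obtain ⟨r, hr, hr₀⟩ := (((eventually_all_finset C).2 fun c hc =>
    eventually_forall_smul_notMem_shadow (o := o) (hCa c hc)).and (eventually_ge_atTop 0)).exists
  obtain ⟨X, hX⟩ := hG.exists_zpow_smul_towards ho (2 * r + 3 * δ + 1)
  refine ⟨shadow o z r, X, ?_, fun k hk s hs => ?_, hr⟩
  · refine (Set.ne_univ_iff_exists_notMem _).2 ⟨o, fun h => ?_⟩
    obtain ⟨i, hi⟩ := Eventually.exists h
    rw [gromovProduct_self_right] at hi
    linarith
  · refine hS.smul_mem_shadow hδ hr₀ (lt_add_one _) (hX k hk) ?_ hs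
    -- The set of exponents is symmetric, so the inverse of `X ^ k` also moves `o` towards the limit
    -- point.
    rw [← zpow_neg]
    refine hX (-k) ?_
    simp only [Finset.mem_insert, Finset.mem_singleton] at hk ⊢
    omega

end Dynamics

end WeakHyp

theorem mainTheorem4 {G : Type u} [Group G]
    (hG : WeakHyp.IsLimFreeWeaklyHyperbolic.{u, v} G)
    (H : Subgroup G) (hnormal : H.Normal)
    (hclosed : IsClosed[WeakHyp.zariskiTopology G] (H : Set G)) :
    H = ⊥ ∨ H = ⊤ := by
  obtain ⟨S, _, _, _, _, hgen, hfree⟩ := hG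
  exact (hgen.hasPingPong hfree).eq_bot_or_eq_top hnormal hclosed
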